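/- Let $\lambda>0$, $\rho>0$, and let $\beta$ be a real function on $[0,\infty)$, integrable on every bounded interval, with $$-\lambda\le \frac1t\int_0^t\beta(u)\,du\le\frac{\lambda}{e^{\rho}-1}\qquad(t>0).$$ Put $h(t)=e^{-\lambda t-\int_0^t\beta(u)\,du}$ and $$G(t)=1-\frac1\lambda\,\frac{(1-e^{-\rho})\,h(t)}{\int_0^\infty h(w)\,dw-(1-e^{-\rho})\int_0^t h(w)\,dw},\qquad t\ge 0,$$ where the quotient is read as $0$ (so $G\equiv1$) if $\int_0^\infty h=\infty$. Consider the $M|G|\infty$ queue, started empty at time $0$, with Poisson arrivals of rate $\lambda$ (independent $\mathrm{Exp}(\lambda)$ interarrival times) and independent nonnegative service times, independent of the arrivals, whose distribution function is this $G$ (in particular, $G$ is assumed to be a distribution function). The idle period is the time until the first arrival, the busy period is the time from the first arrival until no customer is in service (it has length $0$ if the first customer has service time $0$), and the busy cycle is the idle period followed by the busy period. Then the busy period is almost surely finite; the Laplace transforms $\bar Z$ and $\bar B$ of the lengths of the busy cycle and of the busy period satisfy $\bar Z(s)=\frac{\lambda}{\lambda+s}\bar B(s)$ for $s\ge0$;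 and the distribution function $Z$ of the busy cycle length is, for all $t\ge0$, $$Z(t)=\bigl(\lambda e^{-\lambda t}\bigr)*\Bigl(1-(1-G(0))\bigl(h(t)+\lambda\int_0^t h(w)\,dw\bigr)\Bigr)*\sum_{n=0}^\infty\lambda^n(1-G(0))^n\,h^{*n}(t).$$ Here $*$ is convolution on $[0,\infty)$, $h^{*n}$ is the $n$-th convolution power of the measure $h(t)\,dt$ on $[0,\infty)$, with $h^{*0}=\delta_0$ the unit mass at the origin, the series is a measure on $[0,\infty)$, and the convolution integrals over $[0,t]$ converge absolutely. -/

import Mathlib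

open MeasureTheory ProbabilityTheory Set

noncomputable section

namespace MGInf

/-! The infinite-server queue with Poisson arrivals, started empty at time zero. Customer `n`
arrives at time `X 0 + ... + X n` and has service time `S n`. -/

/-- The arrival time of customer `n`, for interarrival times `X`. -/
def arrival {Ω : Type*} (X : ℕ → Ω → ℝ) (n : ℕ) (ω : Ω) : ℝ :=
  ∑ i ∈ Finset.range (n + 1), X i ω

/-- The number of customers being served at time `t`: those arrived and not yet departed. -/
def numBusy {Ω : Type*} (X S : ℕ → Ω → ℝ) (t : ℝ) (ω : Ω) : ℕ∞ :=
  {n : ℕ | arrival X n ω ≤ t ∧ t < arrival X n ω + S n ω}.encard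

/-- The length of the idle period that begins at time zero: it lasts until the first arrival. -/
def idleLength {Ω : Type*} (X : ℕ → Ω → ℝ) (ω : Ω) : ℝ := arrival X 0 ω

/-- The times elapsed since the first arrival at which no customer is being served. -/
def emptyTimes {Ω : Type*} (X S : ℕ → Ω → ℝ) (ω : Ω) : Set ℝ :=
  {u : ℝ | 0 ≤ u ∧ numBusy X S (arrival X 0 ω + u) ω = 0}

/-- The length of the busy period opened by the first customer: the time from the first arrival
until the system is empty. It is `0` if that customer has service time `0`. -/
def busyLength {Ω : Type*} (X S : ℕ → Ω → ℝ) (ω : Ω) : ℝ := sInf (emptyTimes X S ω)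

/-- The length of a busy cycle: an idle period followed by a busy period. -/
def cycleLength {Ω : Type*} (X S : ℕ → Ω → ℝ) (ω : Ω) : ℝ :=
  idleLength X ω + busyLength X S ω

/-- The M/G/∞ queue with arrival rate `lam` and service distribution function `G` (given on
`[0, ∞)`): interarrival times are exponential, service times are nonnegative with distribution
function `G`, and all of them are independent. -/
structure IsQueue {Ω : Type*} [MeasurableSpace Ω] (P : Measure Ω) (lam : ℝ) (G : ℝ → ℝ)
    (X S : ℕ → Ω → ℝ) : Prop where
  measurable_interarrival : ∀ n, Measurable (X n)
  measurable_service : ∀ n, Measurable (S n)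
  law_interarrival : ∀ n, P.map (X n) = expMeasure lam
  service_nonneg : ∀ n, ∀ᵐ ω ∂P, 0 ≤ S n ω
  cdf_service : ∀ n, ∀ t : ℝ, 0 ≤ t → P.real {ω | S n ω ≤ t} = G t
  indep : iIndepFun (fun i : ℕ ⊕ ℕ => Sum.elim X S i) P

/-- `h t = exp (-lam t - ∫₀ᵗ β)`. -/
def kernel (lam : ℝ) (β : ℝ → ℝ) (t : ℝ) : ℝ :=
  Real.exp (-lam * t - ∫ u in (0 : ℝ)..t, β u)

open Classical in
/-- The service distribution function `G` on `[0, ∞)` attached to `β` and `rho`. If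
`∫₀^∞ h = ∞`, the quotient is read as `0`, so that `G = 1`. -/
def serviceCDF (lam rho : ℝ) (β : ℝ → ℝ) (t : ℝ) : ℝ :=
  if IntegrableOn (kernel lam β) (Ioi 0) then
    1 - 1 / lam * ((1 - Real.exp (-rho)) * kernel lam β t /
      ((∫ w in Ioi (0 : ℝ), kernel lam β w) -
        (1 - Real.exp (-rho)) * ∫ w in (0 : ℝ)..t, kernel lam β w))
  else 1

/-- The convolution `(f * m)(t)` of a function `f` on `[0, ∞)` and a measure `m` on `[0, ∞)`. -/
def convMeasure (f : ℝ → ℝ) (m : Measure ℝ) (t : ℝ) : ℝ := ∫ u in Icc 0 t, f (t - u) ∂m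

/-- The convolution `(f * g)(t)` of two functions on `[0, ∞)`. -/
def convFun (f g : ℝ → ℝ) (t : ℝ) : ℝ := ∫ u in Icc 0 t, f (t - u) * g u

/-- The `n`-th convolution power of a measure; the power `0` is the unit mass at the origin. -/
def convPow (m : Measure ℝ) : ℕ → Measure ℝ
  | 0 => Measure.dirac 0
  | n + 1 => Measure.conv (convPow m n) m

/-- The measure `h(t) dt` on `[0, ∞)`. -/
def kernelMeasure (lam : ℝ) (β : ℝ → ℝ) : Measure ℝ :=
  (volume.restrict (Ici 0)).withDensity fun t => ENNReal.ofReal (kernel lam β t)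

/-- The series `∑ₙ lamⁿ (1 - G 0)ⁿ h^{*n}`, as a measure on `[0, ∞)`. -/
def seriesMeasure (lam rho : ℝ) (β : ℝ → ℝ) : Measure ℝ :=
  Measure.sum fun n : ℕ =>
    ENNReal.ofReal (lam ^ n * (1 - serviceCDF lam rho β 0) ^ n) •
      convPow (kernelMeasure lam β) n

/-- `1 - (1 - G 0) (h t + lam ∫₀ᵗ h)`. -/
def firstFactor (lam rho : ℝ) (β : ℝ → ℝ) (t : ℝ) : ℝ :=
  1 - (1 - serviceCDF lam rho β 0) *
    (kernel lam β t + lam * ∫ w in (0 : ℝ)..t, kernel lam β w)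

/-- The busy period expression: `firstFactor` convolved with the series. -/
def busyExpr (lam rho : ℝ) (β : ℝ → ℝ) : ℝ → ℝ :=
  convMeasure (firstFactor lam rho β) (seriesMeasure lam rho β)

end MGInf

end

open MeasureTheory ProbabilityTheory Set

noncomputable section

namespace MGInf

open Filter Topology

/-! Let `p` be `emptyProb`. The service law is built so that `p' = -λ (1 - G) p` with `p 0 = 1`,
that is, `p t = exp (-λ ∫₀ᵗ (1 - G))`, the emptiness probability at time `t` of the queue started
empty; at the same time `p = 1 - c ∫ h` with `c = λ (1 - G 0)` (`serviceCDF_mul_emptyProb`,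
`hasDerivAt_emptyProb`). A time `t` after the first arrival the system is empty with probability `G
t * p t`. Decomposing at the end of the busy period, whose law is `b`, gives the regeneration
equation `G p = b * p` (`IsQueue.integral_regeneration`).

No strong Markov property is used for this, nor the interpretation of `p` as a probability. With a
residual service time `v`, first-step analysis at the next arrival shows that `1_{v ≤ t} p t` solves
the same one-step equation as the expected value of `p` at the time left after emptying
(`emptyProb_one_step`). Iterating `n` times leaves an error at most the `n`-th power of the
probability of an interarrival time `≤ t`, so the two agree in the limit
(`tendsto_integral_emptyingValue`).

Since `p` has a positive limit, letting `t → ∞` in the regeneration equation shows that the busy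
period is almost surely finite (`IsQueue.ae_mem_busyEnds`). Substituting `p = 1 - c ∫ h` turns the
equation into the renewal equation `B = G p + c B * h` for the distribution function `B` of the busy
period, with `G p` equal to `firstFactor`; as `c ∫ h = 1 - e^{-ρ} < 1`, the geometric series solves
it (`integral_renewalMeasure`, `busyExpr_eq`). The busy period does not involve the first
interarrival time, so the cycle is a sum of two independent lengths; this gives the Laplace
transforms and the outer convolution. -/

/-- The kernel extended to the left of the origin by its value at the origin. -/
def extKernel (lam : ℝ) (β : ℝ → ℝ) (t : ℝ) : ℝ := kernel lam β (max t 0)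

/-- The probability `1 - G 0` that a service takes a positive time. -/
def posProb (lam rho : ℝ) (β : ℝ → ℝ) : ℝ := 1 - serviceCDF lam rho β 0

/-- The probability that the system is empty at time `t`. -/
def emptyProb (lam rho : ℝ) (β : ℝ → ℝ) (t : ℝ) : ℝ :=
  1 - lam * posProb lam rho β * ∫ w in (0 : ℝ)..t, extKernel lam β w

/-! ### The kernel, the service law and the emptiness probability -/

section Kernel

variable {lam rho : ℝ} {β : ℝ → ℝ}

lemma extKernel_of_nonneg {t : ℝ} (ht : 0 ≤ t) : extKernel lam β t = kernel lam β t := by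
  simp [extKernel, ht]

lemma kernel_pos (t : ℝ) : 0 < kernel lam β t := Real.exp_pos _

lemma kernel_zero : kernel lam β 0 = 1 := by simp [kernel]

/-- Integrability of `β` is known only to the right of the origin. Replacing `β` by its indicator on
`(0, ∞)` changes no integral from `0` to `max t 0` and makes the primitive continuous on the whole
line. -/
lemma continuous_extKernel (hβ : ∀ t : ℝ, 0 ≤ t → IntervalIntegrable β volume 0 t) :
    Continuous (extKernel lam β) := by
  have hint : ∀ a b, IntervalIntegrable ((Ioi (0 : ℝ)).indicator β) volume a b := by
    have key : ∀ b, IntervalIntegrable ((Ioi (0 : ℝ)).indicator β) volume 0 b := by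
      intro b
      rcases le_total 0 b with hb | hb
      · refine (hβ b hb).congr ?_
        rw [uIoc_of_le hb]
        intro x hx
        simp [hx.1]
      · refine (IntervalIntegrable.refl (a := 0) (f := fun _ => (0 : ℝ))
          (μ := volume) |>.trans (intervalIntegrable_const (c := (0 : ℝ)))).congr ?_
        rw [uIoc_of_ge hb]
        intro x hx
        simp [hx.2]
    intro a b
    exact (key a).symm.trans (key b)
  have hc := intervalIntegral.continuous_primitive hint 0
  have : extKernel lam β = fun t => Real.exp (-lam * max t 0 -
      ∫ u in (0 : ℝ)..max t 0, (Ioi (0 : ℝ)).indicator β u) := by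
    funext t
    simp only [extKernel, kernel]
    congr 2
    refine intervalIntegral.integral_congr_ae (ae_of_all _ ?_)
    rw [uIoc_of_le (le_max_right _ _)]
    intro x hx
    simp [hx.1]
  rw [this]
  fun_prop

lemma extKernel_nonneg (t : ℝ) : 0 ≤ extKernel lam β t := (kernel_pos _).le

lemma integral_extKernel {t : ℝ} (ht : 0 ≤ t) :
    ∫ w in (0 : ℝ)..t, extKernel lam β w = ∫ w in (0 : ℝ)..t, kernel lam β w := by
  refine intervalIntegral.integral_congr fun x hx => ?_
  rw [uIcc_of_le ht] at hx
  exact extKernel_of_nonneg hx.1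

lemma integral_kernel_nonneg {t : ℝ} (ht : 0 ≤ t) : 0 ≤ ∫ w in (0 : ℝ)..t, kernel lam β w :=
  intervalIntegral.integral_nonneg ht fun _ _ => (kernel_pos _).le

lemma integral_kernel_le (hI : IntegrableOn (kernel lam β) (Ioi 0)) {t : ℝ} (ht : 0 ≤ t) :
    ∫ w in (0 : ℝ)..t, kernel lam β w ≤ ∫ w in Ioi (0 : ℝ), kernel lam β w := by
  rw [intervalIntegral.integral_of_le ht]
  exact setIntegral_mono_set hI (ae_of_all _ fun _ => (kernel_pos _).le)
    (Eventually.of_forall Ioc_subset_Ioi_self)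

lemma integral_Ioi_kernel_pos (hI : IntegrableOn (kernel lam β) (Ioi 0)) :
    0 < ∫ w in Ioi (0 : ℝ), kernel lam β w := by
  refine lt_of_lt_of_le ?_ (integral_kernel_le hI zero_le_one)
  refine intervalIntegral.intervalIntegral_pos_of_pos ?_ (fun x => kernel_pos x) one_pos
  rw [intervalIntegrable_iff_integrableOn_Ioc_of_le zero_le_one]
  exact hI.mono_set Ioc_subset_Ioi_self

lemma posProb_of_not_integrable (hI : ¬ IntegrableOn (kernel lam β) (Ioi 0)) :
    posProb lam rho β = 0 := by
  simp [posProb, serviceCDF, hI]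

lemma posProb_of_integrable (hI : IntegrableOn (kernel lam β) (Ioi 0)) :
    posProb lam rho β = (1 - Real.exp (-rho)) / (lam * ∫ w in Ioi (0 : ℝ), kernel lam β w) := by
  simp only [posProb, serviceCDF, hI, if_true, kernel_zero, intervalIntegral.integral_same]
  rw [div_mul_eq_div_mul_one_div]
  ring

lemma rate_mul_posProb_mul (hlam : 0 < lam) (hI : IntegrableOn (kernel lam β) (Ioi 0)) :
    lam * posProb lam rho β * ∫ w in Ioi (0 : ℝ), kernel lam β w = 1 - Real.exp (-rho) := by
  have := integral_Ioi_kernel_pos hI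
  rw [posProb_of_integrable hI]
  field_simp

lemma one_sub_exp_neg_pos (hrho : 0 < rho) : 0 < 1 - Real.exp (-rho) := by
  simp [hrho]

lemma posProb_nonneg (hlam : 0 < lam) (hrho : 0 < rho) : 0 ≤ posProb lam rho β := by
  by_cases hI : IntegrableOn (kernel lam β) (Ioi 0)
  · rw [posProb_of_integrable hI]
    have := integral_Ioi_kernel_pos hI
    have := one_sub_exp_neg_pos hrho
    positivity
  · rw [posProb_of_not_integrable hI]

lemma emptyProb_of_nonneg {t : ℝ} (ht : 0 ≤ t) : emptyProb lam rho β t =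
    1 - lam * posProb lam rho β * ∫ w in (0 : ℝ)..t, kernel lam β w := by
  rw [emptyProb, integral_extKernel ht]

lemma emptyProb_le_one (hlam : 0 < lam) (hrho : 0 < rho) {t : ℝ} (ht : 0 ≤ t) :
    emptyProb lam rho β t ≤ 1 := by
  rw [emptyProb_of_nonneg ht]
  have := posProb_nonneg (β := β) hlam hrho
  have := integral_kernel_nonneg (lam := lam) (β := β) ht
  have : 0 ≤ lam * posProb lam rho β * ∫ w in (0 : ℝ)..t, kernel lam β w := by positivity
  linarith

lemma emptyProb_pos (hlam : 0 < lam) (hrho : 0 < rho) {t : ℝ} (ht : 0 ≤ t) :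
    0 < emptyProb lam rho β t := by
  rw [emptyProb_of_nonneg ht]
  by_cases hI : IntegrableOn (kernel lam β) (Ioi 0)
  · have h1 := mul_le_mul_of_nonneg_left (integral_kernel_le hI ht)
      (mul_nonneg hlam.le (posProb_nonneg (β := β) hlam hrho))
    rw [rate_mul_posProb_mul hlam hI] at h1
    have := Real.exp_pos (-rho)
    linarith
  · simp [posProb_of_not_integrable hI]

/-- The limit is `e^{-ρ}` if `∫ h < ∞` and `1` otherwise. Only its positivity matters: it can be
cancelled when the regeneration equation is taken to infinity. -/
lemma exists_tendsto_emptyProb (hlam : 0 < lam) :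
    ∃ L, 0 < L ∧ Tendsto (emptyProb lam rho β) atTop (𝓝 L) := by
  by_cases hI : IntegrableOn (kernel lam β) (Ioi 0)
  · refine ⟨Real.exp (-rho), Real.exp_pos _, ?_⟩
    have h1 := (intervalIntegral_tendsto_integral_Ioi 0 hI tendsto_id).const_mul
      (lam * posProb lam rho β)
    have h2 := h1.const_sub 1
    rw [rate_mul_posProb_mul hlam hI, sub_sub_cancel] at h2
    refine h2.congr' ?_
    filter_upwards [eventually_ge_atTop 0] with t ht
    rw [emptyProb_of_nonneg ht, id]
  · have h : emptyProb lam rho β = fun _ => 1 := by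
      funext t
      simp [emptyProb, posProb_of_not_integrable hI]
    exact ⟨1, one_pos, h ▸ tendsto_const_nhds⟩

lemma hasDerivAt_emptyProb (hβ : ∀ t : ℝ, 0 ≤ t → IntervalIntegrable β volume 0 t) (t : ℝ) :
    HasDerivAt (emptyProb lam rho β) (-(lam * (posProb lam rho β * extKernel lam β t))) t := by
  have h := (continuous_extKernel (lam := lam) hβ).integral_hasStrictDerivAt 0 t |>.hasDerivAt
  have := (h.const_mul (lam * posProb lam rho β)).const_sub 1
  rw [mul_assoc] at this
  exact this

/-- The linear relation between `G` and the emptiness probability, equivalent to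
`emptyProb' = -lam (1 - G) emptyProb`. -/
lemma serviceCDF_mul_emptyProb (hlam : 0 < lam) (hrho : 0 < rho) {t : ℝ} (ht : 0 ≤ t) :
    serviceCDF lam rho β t * emptyProb lam rho β t =
      emptyProb lam rho β t - posProb lam rho β * extKernel lam β t := by
  have hp := emptyProb_pos (β := β) hlam hrho ht
  rw [extKernel_of_nonneg ht]
  rw [emptyProb_of_nonneg ht] at hp ⊢
  by_cases hI : IntegrableOn (kernel lam β) (Ioi 0)
  · have hH := integral_Ioi_kernel_pos hI
    rw [posProb_of_integrable hI] at hp ⊢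
    simp only [serviceCDF, hI, if_true]
    set H := ∫ w in Ioi (0 : ℝ), kernel lam β w
    set I := ∫ w in (0 : ℝ)..t, kernel lam β w
    set c := 1 - Real.exp (-rho)
    -- The denominator in `G` is `H` times the emptiness probability, hence positive; the claim is
    -- then a rational identity.
    have e : 1 - lam * (c / (lam * H)) * I = (H - c * I) / H := by field_simp
    rw [e] at hp ⊢
    have hD : 0 < H - c * I := by
      rcases div_pos_iff.1 hp with h | h
      · exact h.1
      · linarith [h.2]
    field_simp
  · simp [posProb_of_not_integrable hI, serviceCDF, hI]

end Kernel

/-! ### Sample paths: the first emptying time as a recursion over arrivals -/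

/-- The times `u ≥ v` at which none of the customers of the path `z` (a sequence of pairs of an
interarrival and a service time) is being served. -/
def pathEmpty (v : ℝ) (z : ℕ → ℝ × ℝ) : Set ℝ :=
  {u | v ≤ u ∧ ∀ n, ¬ (∑ i ∈ Finset.range (n + 1), (z i).1 ≤ u ∧
    u < ∑ i ∈ Finset.range (n + 1), (z i).1 + (z n).2)}

/-- If the system, started with a customer of residual service time `v` and fed with the path `z`,
becomes empty for the first time at `r`, after fewer than `n` arrivals, then the value is
`g (t - r)`; otherwise it is `0`. -/
def emptyingValue (g : ℝ → ℝ) : ℕ → ℝ → ℝ → (ℕ → ℝ × ℝ) → ℝ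
  | 0, _, _, _ => 0
  | n + 1, v, t, z => if v < (z 0).1 then g (t - v) else
      emptyingValue g n (max (v - (z 0).1) (z 0).2) (t - (z 0).1) fun i => z (i + 1)

/-- An arrival no later than `v` merges with the current residual: seen from that arrival, the
system stays busy at least for the maximum of what remains of `v` and the new service time. -/
lemma mem_pathEmpty_shift {v : ℝ} {z : ℕ → ℝ × ℝ} (hv : (z 0).1 ≤ v) (u : ℝ) :
    u ∈ pathEmpty v z ↔
      u - (z 0).1 ∈ pathEmpty (max (v - (z 0).1) (z 0).2) fun i => z (i + 1) := by
  simp only [pathEmpty, mem_ofPred_eq, max_le_iff]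
  constructor
  · rintro ⟨h1, h2⟩
    refine ⟨⟨by linarith, ?_⟩, fun n hn => h2 (n + 1) ?_⟩
    · by_contra! h
      exact h2 0 (by simp; constructor <;> linarith)
    · rw [Finset.sum_range_succ']
      constructor <;> linarith [hn.1, hn.2]
  · rintro ⟨⟨h1, h2⟩, h3⟩
    refine ⟨by linarith, fun n hn => ?_⟩
    rcases n with _ | n
    · simp at hn
      linarith [hn.2]
    · rw [Finset.sum_range_succ'] at hn
      exact h3 n (by constructor <;> linarith [hn.1, hn.2])

lemma isLeast_pathEmpty_of_lt {v : ℝ} {z : ℕ → ℝ × ℝ} (hz : ∀ i, 0 ≤ (z i).1)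
    (hv : v < (z 0).1) : IsLeast (pathEmpty v z) v := by
  refine ⟨⟨le_rfl, fun n hn => ?_⟩, fun u hu => hu.1⟩
  have : (z 0).1 ≤ ∑ i ∈ Finset.range (n + 1), (z i).1 :=
    Finset.single_le_sum (f := fun i => (z i).1) (fun i _ => hz i) (by simp)
  linarith [hn.1]

/-- Induction on the number of arrivals, shifting the path by one customer. The time `r` does not
depend on `g`, `t` or `m`, so one choice of `g` can detect emptying, another read off its time, and
a third give the regeneration equation. -/
lemma emptyingValue_dichotomy (n : ℕ) (v : ℝ) (z : ℕ → ℝ × ℝ) (hz : ∀ i, 0 ≤ (z i).1) :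
    (∀ g t, emptyingValue g n v t z = 0) ∨
      ∃ r, IsLeast (pathEmpty v z) r ∧ ∀ m, n ≤ m → ∀ g t, emptyingValue g m v t z = g (t - r) := by
  induction n generalizing v z with
  | zero => exact Or.inl fun _ _ => rfl
  | succ n ih =>
    by_cases hv : v < (z 0).1
    · refine Or.inr ⟨v, isLeast_pathEmpty_of_lt hz hv, fun m hm g t => ?_⟩
      obtain ⟨m, rfl⟩ := Nat.exists_eq_add_of_le' (le_trans (Nat.le_add_left 1 n) hm)
      simp [emptyingValue, hv]
    · rcases ih (max (v - (z 0).1) (z 0).2) (fun i => z (i + 1)) (fun i => hz _) with h | h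
      · left
        intro g t
        simp [emptyingValue, hv, h]
      · obtain ⟨r, hr, h⟩ := h
        refine Or.inr ⟨r + (z 0).1, ⟨?_, fun u hu => ?_⟩, fun m hm g t => ?_⟩
        · rw [mem_pathEmpty_shift (not_lt.1 hv), add_sub_cancel_right]
          exact hr.1
        · have := hr.2 ((mem_pathEmpty_shift (not_lt.1 hv) u).1 hu)
          linarith
        · obtain ⟨m, rfl⟩ := Nat.exists_eq_add_of_le' (le_trans (Nat.le_add_left 1 n) hm)
          simp only [emptyingValue, hv, if_false]
          rw [h m (by omega)]
          congr 1
          ring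

lemma measurable_emptyingValue {g : ℝ → ℝ} (hg : Measurable g) (n : ℕ) :
    Measurable fun a : ℝ × ℝ × (ℕ → ℝ × ℝ) => emptyingValue g n a.1 a.2.1 a.2.2 := by
  induction n with
  | zero => exact measurable_const
  | succ n ih =>
    refine Measurable.ite ?_ (hg.comp (by fun_prop)) ?_
    · exact measurableSet_lt (by fun_prop) (by fun_prop)
    · have h : Measurable fun a : ℝ × ℝ × (ℕ → ℝ × ℝ) =>
          ((max (a.1 - (a.2.2 0).1) (a.2.2 0).2, a.2.1 - (a.2.2 0).1,
            fun i => a.2.2 (i + 1)) : ℝ × ℝ × (ℕ → ℝ × ℝ)) := by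
        refine Measurable.prodMk (by fun_prop) (Measurable.prodMk (by fun_prop) ?_)
        exact measurable_pi_lambda _ fun i => by fun_prop
      exact ih.comp h

lemma abs_emptyingValue_le {g : ℝ → ℝ} {C : ℝ} (hC : 0 ≤ C) (hg : ∀ y, |g y| ≤ C) (n : ℕ)
    (v t : ℝ) (z : ℕ → ℝ × ℝ) : |emptyingValue g n v t z| ≤ C := by
  induction n generalizing v t z with
  | zero => simpa [emptyingValue]
  | succ n ih =>
    rw [emptyingValue]
    split_ifs
    exacts [hg _, ih _ _ _]

/-- The path of interarrival and service times from customer `k` on. -/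
def pathFrom {Ω : Type*} (X S : ℕ → Ω → ℝ) (k : ℕ) (ω : Ω) : ℕ → ℝ × ℝ :=
  fun i => (X (k + i) ω, S (k + i) ω)

section Paths

variable {Ω : Type*} {X S : ℕ → Ω → ℝ}

lemma pathFrom_shift (k : ℕ) (ω : Ω) :
    (fun i => pathFrom X S k ω (i + 1)) = pathFrom X S (k + 1) ω := by
  funext i
  simp only [pathFrom]
  rw [show k + (i + 1) = k + 1 + i by ring]

lemma measurable_iSup_comap {I : Set (ℕ ⊕ ℕ)} {i : ℕ ⊕ ℕ} (hi : i ∈ I) :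
    Measurable[⨆ i ∈ I, MeasurableSpace.comap (Sum.elim X S i) inferInstance]
      (Sum.elim X S i) :=
  measurable_iff_comap_le.2 (le_iSup₂_of_le i hi le_rfl)

lemma measurable_pathFrom_iSup {I : Set (ℕ ⊕ ℕ)} {k : ℕ}
    (hi : ∀ j, k ≤ j → Sum.inl j ∈ I ∧ Sum.inr j ∈ I) :
    Measurable[⨆ i ∈ I, MeasurableSpace.comap (Sum.elim X S i) inferInstance]
      (pathFrom X S k) :=
  @measurable_pi_lambda _ _ _ (_) _ _ fun j => @Measurable.prodMk _ _ _ _ _ (_) _ _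
    (measurable_iSup_comap (X := X) (S := S) (hi (k + j) (by omega)).1)
    (measurable_iSup_comap (X := X) (S := S) (hi (k + j) (by omega)).2)

end Paths

/-! ### Independence and laws of the input sequences -/

section Laws

variable {Ω : Type*} [MeasurableSpace Ω] {P : Measure Ω} {lam : ℝ} {G : ℝ → ℝ} {X S : ℕ → Ω → ℝ}

lemma IsQueue.measurable_pathFrom (hQ : IsQueue P lam G X S) (k : ℕ) :
    Measurable (pathFrom X S k) :=
  measurable_pi_lambda _ fun _ => (hQ.measurable_interarrival _).prodMk (hQ.measurable_service _)

/-- Functions of disjoint families of interarrival and service times are independent. -/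
lemma IsQueue.indepFun_of_disjoint (hQ : IsQueue P lam G X S) {I J : Set (ℕ ⊕ ℕ)}
    (hIJ : Disjoint I J) {α γ : Type*} [mα : MeasurableSpace α] [mγ : MeasurableSpace γ]
    {f : Ω → α} {g : Ω → γ}
    (hf : Measurable[⨆ i ∈ I, MeasurableSpace.comap (Sum.elim X S i) inferInstance] f)
    (hg : Measurable[⨆ i ∈ J, MeasurableSpace.comap (Sum.elim X S i) inferInstance] g) :
    IndepFun f g P := by
  have hle : ∀ i, MeasurableSpace.comap (Sum.elim X S i) inferInstance ≤ ‹MeasurableSpace Ω› := by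
    rintro (i | i)
    exacts [(hQ.measurable_interarrival i).comap_le, (hQ.measurable_service i).comap_le]
  have h := indep_iSup_of_disjoint hle hQ.indep hIJ
  rw [IndepFun_iff_Indep]
  exact indep_of_indep_of_le_left (indep_of_indep_of_le_right h hg.comap_le) hf.comap_le

/-- The distribution function is prescribed only on `[0, ∞)`; nonnegativity of the service times
settles the negative half-line. -/
lemma IsQueue.map_service [IsProbabilityMeasure P] (hQ : IsQueue P lam G X S) (n : ℕ) :
    P.map (S n) = P.map (S 0) := by
  have : IsProbabilityMeasure (P.map (S n)) :=
    Measure.isProbabilityMeasure_map (hQ.measurable_service n).aemeasurable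
  refine Measure.ext_of_Iic _ _ fun t => ?_
  rw [Measure.map_apply (hQ.measurable_service n) measurableSet_Iic,
    Measure.map_apply (hQ.measurable_service 0) measurableSet_Iic]
  rcases lt_or_ge t 0 with ht | ht
  · have : ∀ m, P (S m ⁻¹' Iic t) = 0 := fun m =>
      measure_mono_null (fun ω hω => by
        simp only [mem_preimage, mem_Iic] at hω
        simp only [mem_compl_iff, mem_ofPred_eq, not_le]
        linarith) (hQ.service_nonneg m)
    rw [this, this]
  · have := (hQ.cdf_service n t ht).trans (hQ.cdf_service 0 t ht).symm
    exact (measureReal_eq_measureReal_iff).1 this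

lemma measurable_gammaPDF {a r : ℝ} : Measurable (gammaPDF a r) :=
  (measurable_gammaPDFReal a r).ennreal_ofReal

lemma ae_nonneg_expMeasure (lam : ℝ) : ∀ᵐ x ∂expMeasure lam, 0 ≤ x := by
  rw [expMeasure, gammaMeasure, ae_withDensity_iff measurable_gammaPDF]
  refine ae_of_all _ fun x hx => ?_
  by_contra! h
  exact hx (gammaPDF_of_neg h)

lemma IsQueue.interarrival_nonneg (hQ : IsQueue P lam G X S) (n : ℕ) :
    ∀ᵐ ω ∂P, 0 ≤ X n ω :=
  ae_of_ae_map (p := fun x => 0 ≤ x) (hQ.measurable_interarrival n).aemeasurable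
    (hQ.law_interarrival n ▸ ae_nonneg_expMeasure lam)

lemma IsQueue.map_first_and_rest [IsProbabilityMeasure P] (hQ : IsQueue P lam G X S) (k : ℕ) :
    P.map (fun ω => ((X k ω, S k ω), pathFrom X S (k + 1) ω)) =
      ((expMeasure lam).prod (P.map (S 0))).prod (P.map (pathFrom X S (k + 1))) := by
  have h1 : IndepFun (X k) (S k) P := hQ.indepFun_of_disjoint
    (I := {Sum.inl k}) (J := {Sum.inr k}) (by simp)
    (measurable_iSup_comap (X := X) (S := S) (i := Sum.inl k) rfl)
    (measurable_iSup_comap (X := X) (S := S) (i := Sum.inr k) rfl)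
  have h2 : IndepFun (fun ω => (X k ω, S k ω)) (pathFrom X S (k + 1)) P := by
    refine hQ.indepFun_of_disjoint (I := {Sum.inl k, Sum.inr k})
      (J := {i | ∃ j, k < j ∧ (i = Sum.inl j ∨ i = Sum.inr j)}) ?_ ?_ ?_
    · rw [Set.disjoint_left]
      rintro i (rfl | rfl) ⟨j, hj, h | h⟩ <;> simp at h; all_goals omega
    · exact @Measurable.prodMk _ _ _ _ _ (_) _ _
        (measurable_iSup_comap (X := X) (S := S) (i := Sum.inl k) (by simp))
        (measurable_iSup_comap (X := X) (S := S) (i := Sum.inr k) (by simp))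
    · exact measurable_pathFrom_iSup fun j hj => ⟨⟨j, hj, Or.inl rfl⟩, ⟨j, hj, Or.inr rfl⟩⟩
  have hX := hQ.measurable_interarrival k
  have hS := hQ.measurable_service k
  rw [h2.map_prod_eq_prod_map_map (hX.prodMk hS).aemeasurable
    (hQ.measurable_pathFrom _).aemeasurable,
    h1.map_prod_eq_prod_map_map hX.aemeasurable hS.aemeasurable, hQ.law_interarrival,
    hQ.map_service]

lemma IsQueue.map_service_and_rest [IsProbabilityMeasure P] (hQ : IsQueue P lam G X S) :
    P.map (fun ω => (S 0 ω, pathFrom X S 1 ω)) = (P.map (S 0)).prod (P.map (pathFrom X S 1)) := by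
  refine (hQ.indepFun_of_disjoint (I := {Sum.inr 0})
      (J := {i | ∃ j, 0 < j ∧ (i = Sum.inl j ∨ i = Sum.inr j)}) ?_ ?_ ?_).map_prod_eq_prod_map_map
      (hQ.measurable_service 0).aemeasurable (hQ.measurable_pathFrom _).aemeasurable
  · rw [Set.disjoint_left]
    rintro i rfl ⟨j, hj, h | h⟩ <;> simp at h; all_goals omega
  · exact measurable_iSup_comap (X := X) (S := S) (i := Sum.inr 0) (by simp)
  · exact measurable_pathFrom_iSup fun j hj => ⟨⟨j, hj, Or.inl rfl⟩, ⟨j, hj, Or.inr rfl⟩⟩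

/-- Everything that determines the busy period uses only the variables other than `X 0`. -/
lemma IsQueue.indepFun_idle (hQ : IsQueue P lam G X S) :
    IndepFun (X 0) (fun ω => (S 0 ω, pathFrom X S 1 ω)) P := by
  refine hQ.indepFun_of_disjoint (I := {Sum.inl 0}) (J := {Sum.inl 0}ᶜ) ?_ ?_ ?_
  · exact disjoint_compl_right
  · exact measurable_iSup_comap (X := X) (S := S) (i := Sum.inl 0) (by simp)
  · exact @Measurable.prodMk _ _ _ _ _ (_) _ _
      (measurable_iSup_comap (X := X) (S := S) (i := Sum.inr 0) (by simp))
      (measurable_pathFrom_iSup fun j hj => ⟨by simp; omega, by simp⟩)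

lemma integral_expMeasure (hlam : 0 < lam) (f : ℝ → ℝ) :
    ∫ x, f x ∂expMeasure lam = ∫ x in Ioi (0 : ℝ), lam * Real.exp (-(lam * x)) * f x := by
  rw [expMeasure, gammaMeasure, integral_withDensity_eq_integral_toReal_smul
    measurable_gammaPDF (ae_of_all _ fun _ => ENNReal.ofReal_lt_top),
    ← integral_Ici_eq_integral_Ioi, ← integral_indicator measurableSet_Ici]
  refine integral_congr_ae (ae_of_all _ fun x => ?_)
  have h := exponentialPDF_eq lam x
  rw [exponentialPDF, exponentialPDFReal] at h
  simp only [gammaPDF, h, smul_eq_mul, indicator_apply, mem_Ici]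
  split_ifs with hx
  · rw [ENNReal.toReal_ofReal (by positivity)]
  · simp

end Laws

/-! ### First-step analysis of the emptying time -/

section Emptying

variable {Ω : Type*} [MeasurableSpace Ω] {P : Measure Ω} [IsProbabilityMeasure P]
  {lam : ℝ} {G p d : ℝ → ℝ} {X S : ℕ → Ω → ℝ}

/-- Fubini, splitting the first pair off the path. The starting index `k` stays free, so the laws of
`pathFrom X S k` for different `k` need never be identified. -/
lemma integral_emptyingValue_succ (hlam : 0 < lam) (hQ : IsQueue P lam G X S) {g : ℝ → ℝ}
    (hg : Measurable g) {C : ℝ} (hC : 0 ≤ C) (hgC : ∀ y, |g y| ≤ C) (n k : ℕ) (v t : ℝ) :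
    Integrable (fun a => if v < a.1 then g (t - v) else
        ∫ z, emptyingValue g n (max (v - a.1) a.2) (t - a.1) z ∂P.map (pathFrom X S (k + 1)))
      ((expMeasure lam).prod (P.map (S 0))) ∧
    ∫ z, emptyingValue g (n + 1) v t z ∂P.map (pathFrom X S k) =
      ∫ a, (if v < a.1 then g (t - v) else
        ∫ z, emptyingValue g n (max (v - a.1) a.2) (t - a.1) z ∂P.map (pathFrom X S (k + 1)))
        ∂(expMeasure lam).prod (P.map (S 0)) := by
  have := isProbabilityMeasure_expMeasure hlam
  have : IsProbabilityMeasure (P.map (S 0)) :=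
    Measure.isProbabilityMeasure_map (hQ.measurable_service 0).aemeasurable
  have : IsProbabilityMeasure (P.map (pathFrom X S (k + 1))) :=
    Measure.isProbabilityMeasure_map (hQ.measurable_pathFrom _).aemeasurable
  have hm := measurable_emptyingValue hg
  have hm1 : Measurable fun z => emptyingValue g (n + 1) v t z :=
    (hm (n + 1)).comp (f := fun z : ℕ → ℝ × ℝ => (v, t, z)) (by fun_prop)
  set F : (ℝ × ℝ) × (ℕ → ℝ × ℝ) → ℝ := fun b =>
    if v < b.1.1 then g (t - v) else emptyingValue g n (max (v - b.1.1) b.1.2) (t - b.1.1) b.2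
  have hF : Measurable F := by
    refine Measurable.ite (measurableSet_lt (by fun_prop) (by fun_prop)) measurable_const ?_
    exact (hm n).comp (f := fun b : (ℝ × ℝ) × (ℕ → ℝ × ℝ) =>
      (max (v - b.1.1) b.1.2, t - b.1.1, b.2)) (by fun_prop)
  have hFC : ∀ b, |F b| ≤ C := by
    intro b
    simp only [F]
    split_ifs
    exacts [hgC _, abs_emptyingValue_le hC hgC _ _ _ _]
  have hFi : ∀ μ : Measure ((ℝ × ℝ) × (ℕ → ℝ × ℝ)), IsFiniteMeasure μ → Integrable F μ :=
    fun μ _ => Integrable.of_bound hF.aestronglyMeasurable C (ae_of_all _ hFC)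
  have hFa : (fun a => ∫ z, F (a, z) ∂P.map (pathFrom X S (k + 1))) = fun a =>
      if v < a.1 then g (t - v) else
        ∫ z, emptyingValue g n (max (v - a.1) a.2) (t - a.1) z ∂P.map (pathFrom X S (k + 1)) := by
    funext a
    simp only [F]
    split_ifs <;> simp
  rw [← hFa]
  refine ⟨(hFi _ inferInstance).integral_prod_left, ?_⟩
  calc ∫ z, emptyingValue g (n + 1) v t z ∂P.map (pathFrom X S k)
      = ∫ ω, emptyingValue g (n + 1) v t (pathFrom X S k ω) ∂P :=
        integral_map (hQ.measurable_pathFrom k).aemeasurable hm1.aestronglyMeasurable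
    _ = ∫ ω, F ((X k ω, S k ω), pathFrom X S (k + 1) ω) ∂P := by
        refine integral_congr_ae (ae_of_all _ fun ω => ?_)
        simp only [emptyingValue, F, pathFrom_shift]
        rfl
    _ = ∫ b, F b ∂P.map (fun ω => ((X k ω, S k ω), pathFrom X S (k + 1) ω)) := by
        rw [integral_map _ hF.aestronglyMeasurable]
        exact (((hQ.measurable_interarrival k).prodMk (hQ.measurable_service k)).prodMk
          (hQ.measurable_pathFrom _)).aemeasurable
    _ = _ := by
        rw [hQ.map_first_and_rest, integral_prod _ (hFi _ inferInstance)]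

/-- The balance equation `p' = -lam d`, integrated over the first interarrival time. -/
lemma integral_first_arrival (hlam : 0 < lam) (hp : ∀ y, HasDerivAt p (-(lam * d y)) y)
    (hd : Continuous d) {v t : ℝ} (hv : 0 ≤ v) :
    ∫ x, (if v < x then p (t - v) else p (t - x) - d (t - x)) ∂expMeasure lam = p t := by
  have hpc : Continuous p := continuous_iff_continuousAt.2 fun y => (hp y).continuousAt
  rw [integral_expMeasure hlam, ← Ioc_union_Ioi_eq_Ioi hv]
  have e1 : EqOn (fun x => lam * Real.exp (-(lam * x)) *
      (if v < x then p (t - v) else p (t - x) - d (t - x)))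
      (fun x => lam * Real.exp (-(lam * x)) * (p (t - x) - d (t - x))) (Ioc 0 v) := by
    intro x hx
    simp [not_lt.2 hx.2]
  have e2 : EqOn (fun x => lam * Real.exp (-(lam * x)) *
      (if v < x then p (t - v) else p (t - x) - d (t - x)))
      (fun x => Real.exp (-lam * x) * (lam * p (t - v))) (Ioi v) := by
    intro x hx
    simp only [mem_Ioi.1 hx, if_true, neg_mul]
    ring
  have hc : Continuous fun x => lam * Real.exp (-(lam * x)) * (p (t - x) - d (t - x)) := by
    fun_prop
  -- Past `v` the integral is `e^{-λ v} p (t - v)`; up to `v` the integrand has the primitive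
  -- `-e^{-λ x} p (t - x)`, because `p' = -λ d`. The terms at `v` cancel and the one at `0` leaves
  -- `p t`.
  rw [setIntegral_union Ioc_disjoint_Ioi_same measurableSet_Ioi, setIntegral_congr_fun
    measurableSet_Ioc e1, setIntegral_congr_fun measurableSet_Ioi e2, integral_mul_const,
    integral_exp_mul_Ioi (by linarith), ← intervalIntegral.integral_of_le hv,
    intervalIntegral.integral_eq_sub_of_hasDerivAt (f := fun x => -(Real.exp (-(lam * x)) * p (t - x)))
      _ (hc.intervalIntegrable _ _)]
  · simp only [mul_zero, neg_zero, Real.exp_zero, sub_zero, one_mul, neg_mul]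
    field_simp
    ring
  · intro x _
    have h1 : HasDerivAt (fun x => Real.exp (-(lam * x))) (-(lam * Real.exp (-(lam * x)))) x := by
      convert! (hasDerivAt_neg_exp_mul_exp (r := lam) (x := x)).neg using 1
      funext a
      simp
    have h2 : HasDerivAt (fun x => p (t - x)) (lam * d (t - x)) x := by
      convert! (hp (t - x)).comp x ((hasDerivAt_id x).const_sub t) using 1
      ring
    convert! (h1.mul h2).neg using 1
    ring
  · exact (hc.integrableOn_Icc.mono_set Ioc_subset_Icc_self).congr_fun e1.symm measurableSet_Ioc
  · have h : IntegrableOn (fun x => Real.exp (-lam * x) * (lam * p (t - v))) (Ioi v) :=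
      Integrable.mul_const (integrableOn_exp_mul_Ioi (by linarith) v) _
    exact h.congr_fun e2.symm measurableSet_Ioi

lemma integrable_one_step (hlam : 0 < lam) (hQ : IsQueue P lam G X S)
    (hpc : Continuous p) (hp01 : ∀ y, 0 ≤ y → 0 ≤ p y ∧ p y ≤ 1) (v t : ℝ) :
    Integrable (fun a : ℝ × ℝ => if v < a.1 then (if 0 ≤ t - v then p (t - v) else 0) else
        if max (v - a.1) a.2 ≤ t - a.1 then p (t - a.1) else 0)
        ((expMeasure lam).prod (P.map (S 0))) := by
  have := isProbabilityMeasure_expMeasure hlam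
  have : IsProbabilityMeasure (P.map (S 0)) :=
    Measure.isProbabilityMeasure_map (hQ.measurable_service 0).aemeasurable
  refine Integrable.of_bound ?_ 1 ?_
  · refine Measurable.aestronglyMeasurable ?_
    refine Measurable.ite (measurableSet_lt (by fun_prop) (by fun_prop)) (by fun_prop) ?_
    exact Measurable.ite (measurableSet_le (by fun_prop) (by fun_prop)) (by fun_prop)
      measurable_const
  · refine ae_of_all _ fun a => ?_
    split_ifs with h1 h2 h3
    · rw [Real.norm_of_nonneg (hp01 _ h2).1]
      exact (hp01 _ h2).2
    · simp
    · have : 0 ≤ t - a.1 := by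
        linarith [le_max_left (v - a.1) a.2]
      rw [Real.norm_of_nonneg (hp01 _ this).1]
      exact (hp01 _ this).2
    · simp

/-- One-step equation for the probability that the system, started with a customer of residual
service time `v`, is empty at time `t`. -/
lemma emptyProb_one_step (hlam : 0 < lam) (hQ : IsQueue P lam G X S)
    (hp : ∀ y, HasDerivAt p (-(lam * d y)) y) (hd : Continuous d)
    (hG : ∀ y, 0 ≤ y → G y * p y = p y - d y) (hp01 : ∀ y, 0 ≤ y → 0 ≤ p y ∧ p y ≤ 1)
    {v t : ℝ} (hv : 0 ≤ v) :
    ∫ a, (if v < a.1 then (if 0 ≤ t - v then p (t - v) else 0) else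
        if max (v - a.1) a.2 ≤ t - a.1 then p (t - a.1) else 0)
        ∂(expMeasure lam).prod (P.map (S 0)) = if v ≤ t then p t else 0 := by
  have := isProbabilityMeasure_expMeasure hlam
  have : IsProbabilityMeasure (P.map (S 0)) :=
    Measure.isProbabilityMeasure_map (hQ.measurable_service 0).aemeasurable
  have hpc : Continuous p := continuous_iff_continuousAt.2 fun y => (hp y).continuousAt
  by_cases hvt : v ≤ t
  · rw [if_pos hvt]
    refine Eq.trans ?_ (integral_first_arrival (t := t) hlam hp hd hv)
    rw [integral_prod _ (integrable_one_step hlam hQ hpc hp01 v t)]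
    refine integral_congr_ae ?_
    filter_upwards [ae_nonneg_expMeasure lam] with x hx
    split_ifs with h1 h2
    · simp
    · linarith
    -- Since `v ≤ t`, only the new service time is constrained. Integrating over it gives `G (t - x)
    -- * p (t - x)`, which is `p - d` at `t - x`.
    · have h4 : ∀ s, (if max (v - x) s ≤ t - x then p (t - x) else 0) =
          (Iic (t - x)).indicator (fun _ => p (t - x)) s := by
        intro s
        simp [indicator_apply, hvt]
      have h5 : 0 ≤ t - x := by linarith
      simp only [h4]
      rw [integral_indicator_const _ measurableSet_Iic, smul_eq_mul,
        map_measureReal_apply (hQ.measurable_service 0) measurableSet_Iic, ← hG _ h5,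
        ← hQ.cdf_service 0 _ h5]
      rfl
  · rw [if_neg hvt]
    refine (integral_congr_ae (ae_of_all _ fun a => ?_)).trans (integral_zero _ _)
    have h1 : ¬ 0 ≤ t - v := by linarith
    have h2 : ¬ max (v - a.1) a.2 ≤ t - a.1 := fun h => by
      linarith [le_max_left (v - a.1) a.2]
    simp [h1, h2]

/-- Both quantities obey the same one-step recursion and agree on the event that the system empties
before the next arrival. Each step thus costs a factor `P(interarrival ≤ T)`. The bound `0` for `t <
0` is what discards arrivals after `t`, and the fixed `T ≥ t` keeps the factor the same as `t`
decreases. -/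
lemma abs_emptyProb_sub_integral_le (hlam : 0 < lam) (hQ : IsQueue P lam G X S)
    (hp : ∀ y, HasDerivAt p (-(lam * d y)) y) (hd : Continuous d)
    (hG : ∀ y, 0 ≤ y → G y * p y = p y - d y) (hp01 : ∀ y, 0 ≤ y → 0 ≤ p y ∧ p y ≤ 1)
    {T : ℝ} (n k : ℕ) {v t : ℝ} (hv : 0 ≤ v) (ht : t ≤ T) :
    |(if v ≤ t then p t else 0) - ∫ z, emptyingValue (fun y => if 0 ≤ y then p y else 0) n v t z
        ∂P.map (pathFrom X S k)| ≤ if 0 ≤ t then (expMeasure lam).real (Iic T) ^ n else 0 := by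
  have := isProbabilityMeasure_expMeasure hlam
  have : IsProbabilityMeasure (P.map (S 0)) :=
    Measure.isProbabilityMeasure_map (hQ.measurable_service 0).aemeasurable
  have hpc : Continuous p := continuous_iff_continuousAt.2 fun y => (hp y).continuousAt
  have hgm : Measurable fun y => if 0 ≤ y then p y else 0 :=
    Measurable.ite measurableSet_Ici hpc.measurable measurable_const
  have hgC : ∀ y, |if 0 ≤ y then p y else 0| ≤ 1 := by
    intro y
    split_ifs with h
    · rw [abs_of_nonneg (hp01 _ h).1]
      exact (hp01 _ h).2
    · simp
  set a := (expMeasure lam).real (Iic T)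
  induction n generalizing k v t with
  | zero =>
    simp only [emptyingValue, integral_zero, sub_zero, pow_zero]
    by_cases h : v ≤ t
    · rw [if_pos h, if_pos (hv.trans h), abs_of_nonneg (hp01 _ (hv.trans h)).1]
      exact (hp01 _ (hv.trans h)).2
    · rw [if_neg h, abs_zero]
      split_ifs <;> simp
  | succ n ih =>
    obtain ⟨hi, he⟩ := integral_emptyingValue_succ hlam hQ hgm zero_le_one hgC n k v t
    rw [he, ← emptyProb_one_step hlam hQ hp hd hG hp01 hv,
      ← integral_sub (integrable_one_step hlam hQ hpc hp01 v t) hi]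
    have hb : Integrable (fun b : ℝ × ℝ => (Iic T).indicator
        (fun _ => if 0 ≤ t then a ^ n else 0) b.1) ((expMeasure lam).prod (P.map (S 0))) :=
      Integrable.comp_fst ((integrable_const _).indicator measurableSet_Iic) _
    have hI : ∫ b, (Iic T).indicator (fun _ => if 0 ≤ t then a ^ n else 0) b.1
        ∂(expMeasure lam).prod (P.map (S 0)) = if 0 ≤ t then a ^ (n + 1) else 0 := by
      rw [integral_prod _ hb]
      simp only [integral_const, probReal_univ, one_smul]
      rw [integral_indicator_const _ measurableSet_Iic, smul_eq_mul]
      split_ifs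
      · rw [pow_succ']
      · simp
    rw [← hI, ← Real.norm_eq_abs]
    refine norm_integral_le_of_norm_le hb ?_
    have h0 : ∀ᵐ b : ℝ × ℝ ∂(expMeasure lam).prod (P.map (S 0)), 0 ≤ b.1 :=
      Measure.quasiMeasurePreserving_fst.ae (ae_nonneg_expMeasure lam)
    filter_upwards [h0] with b hb0
    have hr : 0 ≤ (Iic T).indicator (fun _ => if 0 ≤ t then a ^ n else 0) b.1 := by
      refine indicator_nonneg (fun _ _ => ?_) _
      split_ifs
      exacts [pow_nonneg measureReal_nonneg _, le_rfl]
    by_cases hvb : v < b.1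
    · simpa [hvb] using hr
    · simp only [hvb, if_false]
      refine (ih (k + 1) (v := max (v - b.1) b.2) (t := t - b.1)
        (le_max_of_le_left (by linarith)) (by linarith)).trans ?_
      by_cases h : 0 ≤ t - b.1
      · rw [if_pos h, indicator_of_mem (show b.1 ∈ Iic T by rw [mem_Iic]; linarith),
          if_pos (by linarith)]
      · rwa [if_neg h]

/-- The probability that the system, started with a customer of residual service time `v`, is
empty at time `t`, decomposed at the first time at which it is empty. -/
lemma tendsto_integral_emptyingValue (hlam : 0 < lam) (hQ : IsQueue P lam G X S)
    (hp : ∀ y, HasDerivAt p (-(lam * d y)) y) (hd : Continuous d)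
    (hG : ∀ y, 0 ≤ y → G y * p y = p y - d y) (hp01 : ∀ y, 0 ≤ y → 0 ≤ p y ∧ p y ≤ 1)
    (k : ℕ) {v t : ℝ} (hv : 0 ≤ v) (ht : 0 ≤ t) :
    Tendsto (fun n => ∫ z, emptyingValue (fun y => if 0 ≤ y then p y else 0) n v t z
        ∂P.map (pathFrom X S k)) atTop (𝓝 (if v ≤ t then p t else 0)) := by
  have := isProbabilityMeasure_expMeasure hlam
  have ha : (expMeasure lam).real (Iic t) < 1 := by
    rw [← cdf_eq_real, cdf_expMeasure_eq hlam, if_pos ht]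
    linarith [Real.exp_pos (-(lam * t))]
  rw [tendsto_iff_norm_sub_tendsto_zero]
  refine squeeze_zero (fun _ => norm_nonneg _) (fun n => ?_)
    (tendsto_pow_atTop_nhds_zero_of_lt_one measureReal_nonneg ha)
  rw [norm_sub_rev, Real.norm_eq_abs]
  have := abs_emptyProb_sub_integral_le (t := t) hlam hQ hp hd hG hp01 n k hv le_rfl
  rwa [if_pos ht] at this

end Emptying

/-! ### The busy period: regeneration and almost sure finiteness -/

/-- With time measured from the first arrival, the first customer is just an initial residual
service time, and the path starts at the second customer. -/
lemma emptyTimes_eq_pathEmpty {Ω : Type*} {X S : ℕ → Ω → ℝ} {ω : Ω} (hS : 0 ≤ S 0 ω) :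
    emptyTimes X S ω = pathEmpty (S 0 ω) (pathFrom X S 1 ω) := by
  have hA : ∀ n, arrival X (n + 1) ω =
      (∑ i ∈ Finset.range (n + 1), (pathFrom X S 1 ω i).1) + arrival X 0 ω := by
    intro n
    rw [arrival, Finset.sum_range_succ']
    simp [arrival, pathFrom, add_comm]
  have hN : ∀ n, (pathFrom X S 1 ω n).2 = S (n + 1) ω := fun n => by
    simp [pathFrom, add_comm]
  ext u
  simp only [emptyTimes, numBusy, encard_eq_zero, eq_empty_iff_forall_notMem, mem_ofPred_eq,
    pathEmpty, hN]
  constructor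
  · rintro ⟨h0, h⟩
    refine ⟨?_, fun n hn => h (n + 1) ?_⟩
    · by_contra! h1
      exact h 0 ⟨by linarith, by linarith⟩
    · rw [hA]
      constructor <;> linarith [hn.1, hn.2]
  · rintro ⟨h0, h⟩
    refine ⟨hS.trans h0, fun n hn => ?_⟩
    rcases n with _ | n
    · linarith [hn.2]
    · rw [hA] at hn
      exact h n (by constructor <;> linarith [hn.1, hn.2])

/-- `emptyingValue` for the busy period opened by the first customer. -/
def busyValue {Ω : Type*} (X S : ℕ → Ω → ℝ) (g : ℝ → ℝ) (n : ℕ) (t : ℝ) (ω : Ω) : ℝ :=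
  emptyingValue g n (S 0 ω) t (pathFrom X S 1 ω)

/-- The event that the busy period ends after finitely many arrivals. -/
def busyEnds {Ω : Type*} (X S : ℕ → Ω → ℝ) : Set Ω :=
  {ω | ∃ n, busyValue X S (fun _ => 1) n 0 ω = 1}

lemma measurable_truncation {p : ℝ → ℝ} (hpc : Continuous p) :
    Measurable fun y => if 0 ≤ y then p y else 0 :=
  Measurable.ite measurableSet_Ici hpc.measurable measurable_const

lemma abs_truncation_le {p : ℝ → ℝ} (hp01 : ∀ y, 0 ≤ y → 0 ≤ p y ∧ p y ≤ 1) (y : ℝ) :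
    |if 0 ≤ y then p y else 0| ≤ 1 := by
  split_ifs with h
  · rw [abs_of_nonneg (hp01 _ h).1]
    exact (hp01 _ h).2
  · simp

section Busy

variable {Ω : Type*} [MeasurableSpace Ω] {P : Measure Ω}
  {lam : ℝ} {G p d : ℝ → ℝ} {X S : ℕ → Ω → ℝ}

lemma IsQueue.measurable_busyValue (hQ : IsQueue P lam G X S) {g : ℝ → ℝ} (hg : Measurable g)
    (n : ℕ) (t : ℝ) : Measurable (busyValue X S g n t) :=
  (measurable_emptyingValue hg n).comp (f := fun ω => (S 0 ω, t, pathFrom X S 1 ω))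
    ((hQ.measurable_service 0).prodMk (measurable_const.prodMk (hQ.measurable_pathFrom 1)))

lemma IsQueue.measurableSet_busyEnds (hQ : IsQueue P lam G X S) :
    MeasurableSet (busyEnds X S) := by
  have : busyEnds X S = ⋃ n, busyValue X S (fun _ => 1) n 0 ⁻¹' {1} := by
    ext ω
    simp [busyEnds]
  rw [this]
  exact .iUnion fun n => hQ.measurable_busyValue measurable_const n 0 (measurableSet_singleton _)

lemma IsQueue.ae_tendsto_busyValue (hQ : IsQueue P lam G X S) :
    ∀ᵐ ω ∂P, (ω ∈ busyEnds X S → IsLeast (emptyTimes X S ω) (busyLength X S ω)) ∧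
      ∀ g t, Tendsto (fun n => busyValue X S g n t ω) atTop
        (𝓝 ((busyEnds X S).indicator (fun ω => g (t - busyLength X S ω)) ω)) := by
  filter_upwards [hQ.service_nonneg 0, ae_all_iff.2 hQ.interarrival_nonneg] with ω hS hX
  have key := fun n => emptyingValue_dichotomy n (S 0 ω) (pathFrom X S 1 ω)
    (fun i => hX (1 + i))
  by_cases h : ∃ n r, IsLeast (pathEmpty (S 0 ω) (pathFrom X S 1 ω)) r ∧
      ∀ m, n ≤ m → ∀ g t, emptyingValue g m (S 0 ω) t (pathFrom X S 1 ω) = g (t - r)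
  · obtain ⟨n, r, hr, h⟩ := h
    rw [← emptyTimes_eq_pathEmpty hS] at hr
    have hB : busyLength X S ω = r := hr.csInf_eq
    have hE : ω ∈ busyEnds X S := ⟨n, h n le_rfl _ _⟩
    refine ⟨fun _ => hB ▸ hr, fun g t => ?_⟩
    rw [indicator_of_mem hE, hB]
    exact tendsto_const_nhds.congr' ((eventually_ge_atTop n).mono fun m hm => (h m hm g t).symm)
  · have h0 : ∀ n g t, busyValue X S g n t ω = 0 := fun n g t =>
      ((key n).resolve_right fun h' => h ⟨n, h'⟩) g t
    have hE : ω ∉ busyEnds X S := by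
      rintro ⟨n, hn⟩
      rw [h0] at hn
      exact zero_ne_one hn
    refine ⟨fun h => absurd h hE, fun g t => ?_⟩
    simp [h0, indicator_of_notMem hE]

/-- Up to a null set, the busy period is a measurable function of the first service time and of
the path from the second customer on. -/
lemma IsQueue.exists_busyLength_ae_eq (hQ : IsQueue P lam G X S)
    (hE : ∀ᵐ ω ∂P, ω ∈ busyEnds X S) : ∃ Φ : ℝ × (ℕ → ℝ × ℝ) → ℝ, Measurable Φ ∧
      busyLength X S =ᵐ[P] fun ω => Φ (S 0 ω, pathFrom X S 1 ω) := by
  -- With `g y = -y` and `t = 0`, the value `g (t - r)` is the emptying time `r` itself.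
  refine ⟨fun b => limsup (fun n => emptyingValue (fun y => -y) n b.1 0 b.2) atTop, ?_, ?_⟩
  · refine Measurable.limsup fun n => ?_
    exact (measurable_emptyingValue measurable_neg n).comp
      (f := fun b : ℝ × (ℕ → ℝ × ℝ) => (b.1, (0 : ℝ), b.2)) (by fun_prop)
  · filter_upwards [hE, hQ.ae_tendsto_busyValue] with ω h1 h2
    have := h2.2 (fun y => -y) 0
    rw [indicator_of_mem h1] at this
    simp only [zero_sub, neg_neg] at this
    exact this.limsup_eq.symm

variable [IsProbabilityMeasure P]

/-- The regeneration equation: the law of the busy period, convolved with the probability that the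
system is empty, is the probability that the system is empty a time `t` after the first arrival. -/
lemma IsQueue.integral_regeneration (hlam : 0 < lam) (hQ : IsQueue P lam G X S)
    (hp : ∀ y, HasDerivAt p (-(lam * d y)) y) (hd : Continuous d)
    (hG : ∀ y, 0 ≤ y → G y * p y = p y - d y) (hp01 : ∀ y, 0 ≤ y → 0 ≤ p y ∧ p y ≤ 1)
    {t : ℝ} (ht : 0 ≤ t) :
    ∫ ω, (busyEnds X S).indicator (fun ω => if 0 ≤ t - busyLength X S ω then
      p (t - busyLength X S ω) else 0) ω ∂P = G t * p t := by
  have hpc : Continuous p := continuous_iff_continuousAt.2 fun y => (hp y).continuousAt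
  set g : ℝ → ℝ := fun y => if 0 ≤ y then p y else 0 with hg
  have hgm : Measurable g := measurable_truncation hpc
  have hgC : ∀ y, |g y| ≤ 1 := abs_truncation_le hp01
  have hσ : IsProbabilityMeasure (P.map (S 0)) :=
    Measure.isProbabilityMeasure_map (hQ.measurable_service 0).aemeasurable
  have hπ : IsProbabilityMeasure (P.map (pathFrom X S 1)) :=
    Measure.isProbabilityMeasure_map (hQ.measurable_pathFrom _).aemeasurable
  -- The limit of the same expectations is computed twice: pathwise here, and in `h3` by integrating
  -- the one-step limit over the first service time.
  have h1 : Tendsto (fun n => ∫ ω, busyValue X S g n t ω ∂P) atTop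
      (𝓝 (∫ ω, (busyEnds X S).indicator (fun ω => g (t - busyLength X S ω)) ω ∂P)) :=
    tendsto_integral_of_dominated_convergence (fun _ => 1)
      (fun n => (hQ.measurable_busyValue hgm n t).aestronglyMeasurable) (integrable_const _)
      (fun n => ae_of_all _ fun ω => abs_emptyingValue_le zero_le_one hgC n _ _ _)
      (hQ.ae_tendsto_busyValue.mono fun ω h => h.2 g t)
  have h2 : ∀ n, ∫ ω, busyValue X S g n t ω ∂P =
      ∫ v, ∫ z, emptyingValue g n v t z ∂P.map (pathFrom X S 1) ∂P.map (S 0) := by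
    intro n
    have hm : Measurable fun b : ℝ × (ℕ → ℝ × ℝ) => emptyingValue g n b.1 t b.2 :=
      (measurable_emptyingValue hgm n).comp (f := fun b : ℝ × (ℕ → ℝ × ℝ) => (b.1, t, b.2))
        (by fun_prop)
    have hi : Integrable (fun b : ℝ × (ℕ → ℝ × ℝ) => emptyingValue g n b.1 t b.2)
        ((P.map (S 0)).prod (P.map (pathFrom X S 1))) :=
      Integrable.of_bound hm.aestronglyMeasurable 1
        (ae_of_all _ fun b => abs_emptyingValue_le zero_le_one hgC n _ _ _)
    rw [← integral_prod (f := fun b : ℝ × (ℕ → ℝ × ℝ) => emptyingValue g n b.1 t b.2) hi,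
      ← hQ.map_service_and_rest, integral_map _ hm.aestronglyMeasurable]
    · rfl
    · exact ((hQ.measurable_service 0).prodMk (hQ.measurable_pathFrom 1)).aemeasurable
  have h3 : Tendsto (fun n => ∫ v, ∫ z, emptyingValue g n v t z ∂P.map (pathFrom X S 1)
      ∂P.map (S 0)) atTop (𝓝 (∫ v, (if v ≤ t then p t else 0) ∂P.map (S 0))) := by
    refine tendsto_integral_of_dominated_convergence (fun _ => 1) (fun n => ?_)
      (integrable_const _) (fun n => ae_of_all _ fun v => ?_) ?_
    · have hm : Measurable fun b : ℝ × (ℕ → ℝ × ℝ) => emptyingValue g n b.1 t b.2 :=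
        (measurable_emptyingValue hgm n).comp (f := fun b : ℝ × (ℕ → ℝ × ℝ) => (b.1, t, b.2))
          (by fun_prop)
      exact hm.stronglyMeasurable.integral_prod_right'.aestronglyMeasurable
    · refine (norm_integral_le_of_norm_le_const (C := 1)
        (ae_of_all _ fun z => abs_emptyingValue_le zero_le_one hgC n _ _ _)).trans ?_
      simp
    · have : ∀ᵐ v ∂P.map (S 0), 0 ≤ v :=
        (ae_map_iff (hQ.measurable_service 0).aemeasurable measurableSet_Ici).2
          (hQ.service_nonneg 0)
      filter_upwards [this] with v hv
      exact tendsto_integral_emptyingValue hlam hQ hp hd hG hp01 1 hv ht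
  have h4 : ∫ v, (if v ≤ t then p t else 0) ∂P.map (S 0) = G t * p t := by
    have : (fun v => if v ≤ t then p t else 0) = (Iic t).indicator (fun _ => p t) := by
      funext v
      simp [indicator_apply]
    rw [this, integral_indicator_const _ measurableSet_Iic, smul_eq_mul,
      map_measureReal_apply (hQ.measurable_service 0) measurableSet_Iic, ← hQ.cdf_service 0 _ ht]
    rfl
  rw [← h4]
  simp only [h2] at h1
  exact tendsto_nhds_unique h1 h3

/-- As `t → ∞` along the integers, the regeneration equation becomes `P(busy period ends) * L = 1 *
L`, and `L > 0` cancels. -/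
lemma IsQueue.ae_mem_busyEnds (hlam : 0 < lam) (hQ : IsQueue P lam G X S)
    (hp : ∀ y, HasDerivAt p (-(lam * d y)) y) (hd : Continuous d)
    (hG : ∀ y, 0 ≤ y → G y * p y = p y - d y) (hp01 : ∀ y, 0 ≤ y → 0 ≤ p y ∧ p y ≤ 1)
    {L : ℝ} (hL : 0 < L) (hpL : Tendsto p atTop (𝓝 L)) : ∀ᵐ ω ∂P, ω ∈ busyEnds X S := by
  have hpc : Continuous p := continuous_iff_continuousAt.2 fun y => (hp y).continuousAt
  set g : ℝ → ℝ := fun y => if 0 ≤ y then p y else 0 with hg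
  have hgm : Measurable g := measurable_truncation hpc
  have hgC : ∀ y, |g y| ≤ 1 := abs_truncation_le hp01
  have hgL : Tendsto g atTop (𝓝 L) := hpL.congr' ((eventually_ge_atTop 0).mono fun y hy => by
    simp [hg, hy])
  have hσ : IsProbabilityMeasure (P.map (S 0)) :=
    Measure.isProbabilityMeasure_map (hQ.measurable_service 0).aemeasurable
  have h1 : Tendsto (fun k : ℕ => ∫ ω, (busyEnds X S).indicator
      (fun ω => g (k - busyLength X S ω)) ω ∂P) atTop
      (𝓝 (∫ ω, (busyEnds X S).indicator (fun _ => L) ω ∂P)) := by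
    refine tendsto_integral_of_dominated_convergence (fun _ => 1) (fun k => ?_)
      (integrable_const _) (fun k => ae_of_all _ fun ω => ?_) (ae_of_all _ fun ω => ?_)
    · exact aestronglyMeasurable_of_tendsto_ae (u := atTop)
        (f := fun n => busyValue X S g n k)
        (fun n => (hQ.measurable_busyValue hgm n k).aestronglyMeasurable)
        (hQ.ae_tendsto_busyValue.mono fun ω h => h.2 g k)
    · by_cases h : ω ∈ busyEnds X S
      · simpa [h] using hgC _
      · simp [h]
    · by_cases h : ω ∈ busyEnds X S
      · simp only [indicator_of_mem h]
        exact hgL.comp (tendsto_atTop_add_const_right _ _ tendsto_natCast_atTop_atTop)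
      · simp [h]
  have h2 : Tendsto (fun k : ℕ => G k * p k) atTop (𝓝 (1 * L)) := by
    refine Tendsto.mul ?_ (hpL.comp tendsto_natCast_atTop_atTop)
    refine ((tendsto_cdf_atTop (P.map (S 0))).comp tendsto_natCast_atTop_atTop).congr fun k => ?_
    rw [Function.comp_apply, cdf_eq_real, map_measureReal_apply (hQ.measurable_service 0)
      measurableSet_Iic, ← hQ.cdf_service 0 _ k.cast_nonneg]
    rfl
  have h3 := tendsto_nhds_unique (h1.congr fun k =>
    hQ.integral_regeneration hlam hp hd hG hp01 k.cast_nonneg) h2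
  rw [integral_indicator_const _ hQ.measurableSet_busyEnds, smul_eq_mul] at h3
  have h4 : P.real (busyEnds X S) = 1 := mul_right_cancel₀ hL.ne' h3
  exact (prob_compl_eq_zero_iff hQ.measurableSet_busyEnds).2 ((ENNReal.toReal_eq_one_iff _).1 h4)

end Busy

/-! ### Convolution powers and the renewal equation -/

section Renewal

variable {m : Measure ℝ} [IsFiniteMeasure m]

instance isFiniteMeasure_convPow (n : ℕ) : IsFiniteMeasure (convPow m n) := by
  induction n with
  | zero => rw [convPow]; infer_instance
  | succ n ih => rw [convPow]; infer_instance

lemma convPow_univ (n : ℕ) : convPow m n univ = m univ ^ n := by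
  induction n with
  | zero => simp [convPow]
  | succ n ih =>
    rw [convPow, Measure.conv, Measure.map_apply (by fun_prop) .univ, preimage_univ,
      Measure.prod_apply .univ]
    simp [ih, pow_succ, mul_comm]

lemma convPow_Iio (hm : m (Iio 0) = 0) (n : ℕ) : convPow m n (Iio 0) = 0 := by
  induction n with
  | zero => simp [convPow]
  | succ n ih =>
    rw [convPow, Measure.conv, Measure.map_apply (by fun_prop) measurableSet_Iio]
    refine measure_mono_null (t := (Iio 0) ×ˢ univ ∪ univ ×ˢ (Iio 0)) ?_ ?_
    · rintro ⟨x, y⟩ h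
      simp only [mem_preimage, mem_Iio, mem_union, mem_prod, mem_univ, and_true, true_and] at h ⊢
      by_contra! h'
      linarith
    · rw [measure_union_null_iff, Measure.prod_prod, Measure.prod_prod, ih, hm]
      simp

/-- The renewal series of the measure `c • m`. -/
def renewalMeasure (c : ℝ) (m : Measure ℝ) : Measure ℝ :=
  Measure.sum fun n : ℕ => ENNReal.ofReal (c ^ n) • convPow m n

variable {c : ℝ}

lemma isFiniteMeasure_renewalMeasure (hc : 0 ≤ c) (hcm : c * m.real univ < 1) :
    IsFiniteMeasure (renewalMeasure c m) := by
  constructor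
  rw [renewalMeasure, Measure.sum_apply _ .univ]
  have h : ∀ n, (ENNReal.ofReal (c ^ n) • convPow m n) univ =
      ENNReal.ofReal ((c * m.real univ) ^ n) := by
    intro n
    rw [Measure.smul_apply, convPow_univ, smul_eq_mul, mul_pow, ENNReal.ofReal_mul (by positivity),
      measureReal_def, ← ENNReal.toReal_pow, ENNReal.ofReal_toReal (by finiteness)]
  simp only [h]
  rw [← ENNReal.ofReal_tsum_of_nonneg (fun n => by positivity)
    (summable_geometric_of_lt_one (by positivity) hcm)]
  exact ENNReal.ofReal_lt_top

lemma renewalMeasure_Iio (hm : m (Iio 0) = 0) : renewalMeasure c m (Iio 0) = 0 := by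
  simp [renewalMeasure, Measure.sum_apply _ measurableSet_Iio, convPow_Iio hm]

/-- The bounded solution of the renewal equation `F = f + c F * m` is `f` convolved with the
renewal series. -/
lemma integral_renewalMeasure (hc : 0 ≤ c) (hcm : c * m.real univ < 1) {F f : ℝ → ℝ}
    (hF : Measurable F) (hFb : ∀ t, |F t| ≤ 1) (hf : Measurable f) (hfb : ∀ t, |f t| ≤ 1)
    (hren : ∀ t, F t = f t + c * ∫ u, F (t - u) ∂m) (t : ℝ) :
    ∫ u, f (t - u) ∂renewalMeasure c m = F t := by
  have := isFiniteMeasure_renewalMeasure hc hcm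
  have hi : ∀ {g : ℝ → ℝ}, Measurable g → (∀ t, |g t| ≤ 1) → ∀ s (μ : Measure ℝ),
      IsFiniteMeasure μ → Integrable (fun u => g (s - u)) μ := fun hg hb s μ _ =>
    Integrable.of_bound (hg.comp (by fun_prop)).aestronglyMeasurable 1 (ae_of_all _ fun _ => hb _)
  have hstep : ∀ n, c * ∫ u, F (t - u) ∂convPow m (n + 1) =
      ∫ u, F (t - u) ∂convPow m n - ∫ u, f (t - u) ∂convPow m n := by
    intro n
    have h1 : Integrable (fun u => F (t - u)) (Measure.conv (convPow m n) m) :=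
      hi hF hFb _ _ inferInstance
    rw [convPow, integral_conv h1, ← integral_const_mul,
      ← integral_sub (hi hF hFb _ _ inferInstance) (hi hf hfb _ _ inferInstance)]
    refine integral_congr_ae (ae_of_all _ fun x => ?_)
    simp only [hren (t - x), ← sub_sub]
    ring
  -- By `hstep` the partial sums telescope; the remainder is at most `(c * m.real univ) ^ n`.
  have hpart : ∀ n, ∑ k ∈ Finset.range n, ∫ u, f (t - u) ∂(ENNReal.ofReal (c ^ k) • convPow m k) =
      F t - c ^ n * ∫ u, F (t - u) ∂convPow m n := by
    intro n
    induction n with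
    | zero => simp [convPow]
    | succ n ih =>
      rw [Finset.sum_range_succ, ih, integral_smul_measure,
        ENNReal.toReal_ofReal (by positivity), smul_eq_mul, pow_succ, mul_assoc, hstep]
      ring
  have hlim : Tendsto (fun n => c ^ n * ∫ u, F (t - u) ∂convPow m n) atTop (𝓝 0) := by
    refine squeeze_zero_norm (fun n => ?_)
      (tendsto_pow_atTop_nhds_zero_of_lt_one (by positivity) hcm)
    rw [norm_mul, Real.norm_of_nonneg (by positivity), mul_pow]
    gcongr
    refine (norm_integral_le_of_norm_le_const (C := 1) (ae_of_all _ fun u => hFb _)).trans ?_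
    rw [one_mul, measureReal_def, convPow_univ, ENNReal.toReal_pow, measureReal_def]
  have hsum := (hasSum_integral_measure (hi hf hfb t (renewalMeasure c m) this)).tendsto_sum_nat
  simp only [hpart] at hsum
  exact tendsto_nhds_unique hsum (by simpa using hlim.const_sub (F t))

/-- Both sides are the mass of `{(y, u) | y + u ≤ t}` under the product measure. -/
lemma integral_real_Iic_comm (b m : Measure ℝ) [IsFiniteMeasure b] [IsFiniteMeasure m] (t : ℝ) :
    ∫ y, m.real (Iic (t - y)) ∂b = ∫ u, b.real (Iic (t - u)) ∂m := by
  have hm : MeasurableSet {a : ℝ × ℝ | a.1 + a.2 ≤ t} :=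
    measurableSet_le (by fun_prop) (by fun_prop)
  have h1 : ∀ y, m.real (Iic (t - y)) =
      ∫ u, {a : ℝ × ℝ | a.1 + a.2 ≤ t}.indicator (fun _ => (1 : ℝ)) (y, u) ∂m := by
    intro y
    rw [← integral_indicator_one measurableSet_Iic]
    congr 1 with u
    simp [indicator_apply, le_sub_iff_add_le']
  have h2 : ∀ u, b.real (Iic (t - u)) =
      ∫ y, {a : ℝ × ℝ | a.1 + a.2 ≤ t}.indicator (fun _ => (1 : ℝ)) (y, u) ∂b := by
    intro u
    rw [← integral_indicator_one measurableSet_Iic]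
    congr 1 with y
    simp [indicator_apply, le_sub_iff_add_le]
  simp only [h1, h2]
  exact integral_integral_swap ((integrable_const _).indicator hm)

end Renewal

/-! ### The series of the theorem and the distribution of the busy period -/

section Series

variable {lam rho : ℝ} {β : ℝ → ℝ}

lemma kernelMeasure_Iio : kernelMeasure lam β (Iio 0) = 0 := by
  refine withDensity_absolutelyContinuous _ _ ?_
  rw [Measure.restrict_apply measurableSet_Iio, (Iio_disjoint_Ici le_rfl).inter_eq, measure_empty]

lemma kernelMeasure_eq_extKernel : kernelMeasure lam β =
    (volume.restrict (Ici 0)).withDensity fun t => ENNReal.ofReal (extKernel lam β t) := by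
  refine withDensity_congr_ae ?_
  filter_upwards [ae_restrict_mem measurableSet_Ici] with t ht
  rw [extKernel_of_nonneg ht]

lemma kernelMeasure_univ (hI : IntegrableOn (kernel lam β) (Ioi 0)) :
    kernelMeasure lam β univ = ENNReal.ofReal (∫ w in Ioi (0 : ℝ), kernel lam β w) := by
  rw [kernelMeasure, withDensity_apply _ .univ, Measure.restrict_univ,
    ← Measure.restrict_congr_set Ioi_ae_eq_Ici,
    ofReal_integral_eq_lintegral_ofReal hI (ae_of_all _ fun _ => (kernel_pos _).le)]

lemma kernelMeasure_Iic (hβ : ∀ t : ℝ, 0 ≤ t → IntervalIntegrable β volume 0 t) {y : ℝ}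
    (hy : 0 ≤ y) : (kernelMeasure lam β).real (Iic y) = ∫ w in (0 : ℝ)..y, extKernel lam β w := by
  have hc := continuous_extKernel (lam := lam) hβ
  rw [measureReal_def, kernelMeasure_eq_extKernel, withDensity_apply _ measurableSet_Iic,
    Measure.restrict_restrict measurableSet_Iic, inter_comm, Ici_inter_Iic,
    ← ofReal_integral_eq_lintegral_ofReal hc.integrableOn_Icc
      (ae_of_all _ fun _ => extKernel_nonneg _),
    ENNReal.toReal_ofReal (integral_nonneg fun _ => extKernel_nonneg _),
    intervalIntegral.integral_of_le hy, integral_Icc_eq_integral_Ioc]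

/-- In both cases `∫ h < ∞` and `∫ h = ∞`, the series is the renewal series of a finite measure. -/
lemma exists_seriesMeasure_eq (hlam : 0 < lam)
    (hβ : ∀ t : ℝ, 0 ≤ t → IntervalIntegrable β volume 0 t) :
    ∃ m : Measure ℝ, IsFiniteMeasure m ∧ m (Iio 0) = 0 ∧
      seriesMeasure lam rho β = renewalMeasure (lam * posProb lam rho β) m ∧
      lam * posProb lam rho β * m.real univ < 1 ∧
      ∀ y, 0 ≤ y → emptyProb lam rho β y = 1 - lam * posProb lam rho β * m.real (Iic y) := by
  by_cases hI : IntegrableOn (kernel lam β) (Ioi 0)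
  · refine ⟨kernelMeasure lam β, ⟨?_⟩, kernelMeasure_Iio, ?_, ?_, fun y hy => ?_⟩
    · rw [kernelMeasure_univ hI]
      exact ENNReal.ofReal_lt_top
    · simp only [seriesMeasure, renewalMeasure, mul_pow, posProb]
    · rw [measureReal_def, kernelMeasure_univ hI,
        ENNReal.toReal_ofReal (integral_Ioi_kernel_pos hI).le, rate_mul_posProb_mul hlam hI]
      linarith [Real.exp_pos (-rho)]
    · rw [kernelMeasure_Iic hβ hy, emptyProb]
  · have h0 := posProb_of_not_integrable (rho := rho) hI
    -- If `∫ h = ∞` then `1 - G 0 = 0`: every term with `n ≥ 1` has coefficient zero, so the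
    -- infinite kernel measure may be replaced by the zero measure.
    refine ⟨0, inferInstance, by simp, ?_, by simp, by simp [emptyProb, h0]⟩
    rw [h0, mul_zero, seriesMeasure, renewalMeasure]
    congr 1 with n : 1
    rw [← mul_pow, ← posProb, h0, mul_zero]
    rcases n with _ | n <;> simp [convPow]

end Series

lemma busyLength_nonneg {Ω : Type*} (X S : ℕ → Ω → ℝ) (ω : Ω) : 0 ≤ busyLength X S ω :=
  Real.sInf_nonneg fun _ h => h.1

section Busy

lemma abs_measureReal_le_one (b : Measure ℝ) [IsProbabilityMeasure b] (s : Set ℝ) :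
    |b.real s| ≤ 1 := by
  rw [abs_of_nonneg measureReal_nonneg]
  exact measureReal_le_one

lemma measurable_real_Iic (b : Measure ℝ) [IsFiniteMeasure b] :
    Measurable fun t => b.real (Iic t) :=
  Monotone.measurable fun _ _ h => measureReal_mono (Iic_subset_Iic.2 h)

variable {lam rho : ℝ} {β : ℝ → ℝ}

lemma firstFactor_of_nonneg {t : ℝ} (ht : 0 ≤ t) : firstFactor lam rho β t =
    emptyProb lam rho β t - posProb lam rho β * extKernel lam β t := by
  rw [emptyProb_of_nonneg ht, extKernel_of_nonneg ht, firstFactor, posProb]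
  ring

/-- The renewal equation for the distribution function of the busy period. -/
lemma busyLength_renewal {b : Measure ℝ} [IsProbabilityMeasure b] (hb : b (Iio 0) = 0)
    {m : Measure ℝ} [IsFiniteMeasure m] (hm : m (Iio 0) = 0) {c : ℝ} {p f : ℝ → ℝ}
    (hp : ∀ y, 0 ≤ y → p y = 1 - c * m.real (Iic y))
    (hreg : ∀ t, 0 ≤ t → ∫ y, (if 0 ≤ t - y then p (t - y) else 0) ∂b = f t) (t : ℝ) :
    b.real (Iic t) = (if 0 ≤ t then f t else 0) + c * ∫ u, b.real (Iic (t - u)) ∂m := by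
  have hneg : ∀ {μ : Measure ℝ} {s : ℝ}, μ (Iio 0) = 0 → s < 0 → μ.real (Iic s) = 0 :=
    fun h hs => by
      rw [measureReal_def, measure_mono_null (Iic_subset_Iio.2 hs) h, ENNReal.toReal_zero]
  split_ifs with ht
  · rw [← hreg t ht, ← integral_real_Iic_comm]
    -- The truncation of `p` falls only on the constant `1`, since `m` has no mass below `0`;
    -- integrated against `b`, that constant gives the distribution function.
    have h1 : ∀ y, (if 0 ≤ t - y then p (t - y) else 0) =
        (Iic t).indicator (fun _ => (1 : ℝ)) y - c * m.real (Iic (t - y)) := by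
      intro y
      split_ifs with h
      · rw [hp _ h, indicator_of_mem (by simpa using h)]
      · rw [indicator_of_notMem (by simpa using h), hneg hm (not_le.1 h)]
        simp
    simp only [h1]
    rw [integral_sub ((integrable_const _).indicator measurableSet_Iic), integral_const_mul,
      integral_indicator_const _ measurableSet_Iic]
    · simp
    · refine Integrable.const_mul (Integrable.of_bound
        ((measurable_real_Iic m).comp (by fun_prop)).aestronglyMeasurable (m.real univ)
        (ae_of_all _ fun y => ?_)) _
      rw [Function.comp_apply, Real.norm_of_nonneg measureReal_nonneg]
      exact measureReal_mono (subset_univ _)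
  · have h0 : ∀ᵐ u ∂m, b.real (Iic (t - u)) = 0 := by
      have : ∀ᵐ u ∂m, u ∉ Iio 0 := measure_eq_zero_iff_ae_notMem.1 hm
      filter_upwards [this] with u hu
      exact hneg hb (by simp at hu; linarith)
    rw [hneg hb (not_le.1 ht), integral_congr_ae h0]
    simp

variable {Ω : Type*} [MeasurableSpace Ω] {P : Measure Ω} [IsProbabilityMeasure P]
  {X S : ℕ → Ω → ℝ}

/-- The distribution function of the busy period. -/
lemma busyExpr_eq (hlam : 0 < lam) (hrho : 0 < rho)
    (hβ : ∀ t : ℝ, 0 ≤ t → IntervalIntegrable β volume 0 t)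
    (hQ : IsQueue P lam (serviceCDF lam rho β) X S) (hE : ∀ᵐ ω ∂P, ω ∈ busyEnds X S)
    (hB : AEMeasurable (busyLength X S) P) (t : ℝ) :
    IntegrableOn (fun u => firstFactor lam rho β (t - u)) (Icc 0 t) (seriesMeasure lam rho β) ∧
      busyExpr lam rho β t = (P.map (busyLength X S)).real (Iic t) := by
  obtain ⟨m, hmf, hm0, hser, hlt, hpm⟩ := exists_seriesMeasure_eq (rho := rho) hlam hβ
  have hb : IsProbabilityMeasure (P.map (busyLength X S)) := Measure.isProbabilityMeasure_map hB
  have hb0 : P.map (busyLength X S) (Iio 0) = 0 := by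
    rw [Measure.map_apply_of_aemeasurable hB measurableSet_Iio]
    convert! measure_empty (μ := P)
    ext ω
    simp [busyLength_nonneg]
  have hc : 0 ≤ lam * posProb lam rho β := mul_nonneg hlam.le (posProb_nonneg hlam hrho)
  have hpc : Continuous (emptyProb lam rho β) :=
    continuous_iff_continuousAt.2 fun y => (hasDerivAt_emptyProb hβ y).continuousAt
  have hkc := continuous_extKernel (lam := lam) hβ
  set f : ℝ → ℝ := fun t => if 0 ≤ t then
    emptyProb lam rho β t - posProb lam rho β * extKernel lam β t else 0 with hf
  have hfm : Measurable f := Measurable.ite measurableSet_Ici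
    (hpc.sub (continuous_const.mul hkc)).measurable measurable_const
  have hp01 : ∀ y, 0 ≤ y → 0 ≤ emptyProb lam rho β y ∧ emptyProb lam rho β y ≤ 1 := fun y hy =>
    ⟨(emptyProb_pos hlam hrho hy).le, emptyProb_le_one hlam hrho hy⟩
  -- On `[0, ∞)` the function `f` is `G` times the emptiness probability, a product of two numbers
  -- in `[0, 1]`.
  have hfb : ∀ t, |f t| ≤ 1 := by
    intro t
    simp only [hf]
    split_ifs with h
    · rw [← serviceCDF_mul_emptyProb hlam hrho h, ← hQ.cdf_service 0 t h, abs_of_nonneg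
        (mul_nonneg measureReal_nonneg (hp01 t h).1)]
      exact mul_le_one₀ measureReal_le_one (hp01 t h).1 (hp01 t h).2
    · simp
  have hreg : ∀ t, 0 ≤ t → ∫ y, (if 0 ≤ t - y then emptyProb lam rho β (t - y) else 0)
      ∂P.map (busyLength X S) =
        emptyProb lam rho β t - posProb lam rho β * extKernel lam β t := by
    intro t ht
    rw [integral_map hB, ← serviceCDF_mul_emptyProb hlam hrho ht,
      ← hQ.integral_regeneration (d := fun y => posProb lam rho β * extKernel lam β y) hlam
        (hasDerivAt_emptyProb hβ) (continuous_const.mul hkc)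
        (fun y hy => serviceCDF_mul_emptyProb hlam hrho hy) hp01 ht]
    · refine integral_congr_ae (hE.mono fun ω hω => ?_)
      simp only [indicator_of_mem hω]
    · exact ((measurable_truncation hpc).comp (measurable_const.sub
        measurable_id)).aestronglyMeasurable
  have hR := isFiniteMeasure_renewalMeasure hc hlt
  have hR0 : ∀ᵐ u ∂renewalMeasure (lam * posProb lam rho β) m, u ∉ Iio 0 :=
    measure_eq_zero_iff_ae_notMem.1 (renewalMeasure_Iio hm0)
  have key := integral_renewalMeasure hc hlt (measurable_real_Iic (P.map (busyLength X S)))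
    (fun _ => abs_measureReal_le_one _ _) hfm hfb
    (busyLength_renewal hb0 hm0 hpm hreg) t
  have hcongr : EqOn (fun u => f (t - u)) (fun u => firstFactor lam rho β (t - u)) (Icc 0 t) := by
    intro u hu
    have h : 0 ≤ t - u := by linarith [hu.2]
    simp only [hf, if_pos h, firstFactor_of_nonneg h]
  have hint : Integrable (fun u => f (t - u)) (renewalMeasure (lam * posProb lam rho β) m) :=
    Integrable.of_bound (hfm.comp (by fun_prop)).aestronglyMeasurable 1 (ae_of_all _ fun _ => hfb _)
  rw [hser]
  refine ⟨hint.integrableOn.congr_fun hcongr measurableSet_Icc, ?_⟩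
  rw [← key, busyExpr, convMeasure, hser, ← setIntegral_congr_fun measurableSet_Icc hcongr]
  -- Outside `[0, t]` nothing contributes: the series has no mass below `0`, and `f (t - u) = 0` for
  -- `u > t`.
  refine setIntegral_eq_integral_of_ae_compl_eq_zero (hR0.mono fun u hu hu' => ?_)
  have : ¬ 0 ≤ t - u := fun h => hu' ⟨by simpa using hu, by linarith⟩
  simp only [hf, if_neg this]

end Busy

/-! ### Adding the idle period -/

section Cycle

lemma integral_exp_neg_mul_expMeasure {lam s : ℝ} (hlam : 0 < lam) (hs : 0 ≤ s) :
    ∫ x, Real.exp (-s * x) ∂expMeasure lam = lam / (lam + s) := by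
  rw [integral_expMeasure hlam]
  have : ∀ x, lam * Real.exp (-(lam * x)) * Real.exp (-s * x) =
      lam * Real.exp (-(lam + s) * x) := by
    intro x
    rw [mul_assoc, ← Real.exp_add]
    ring_nf
  simp only [this]
  rw [integral_const_mul, integral_exp_mul_Ioi (by linarith)]
  have : lam + s ≠ 0 := by positivity
  simp only [mul_zero, Real.exp_zero]
  field_simp

/-- The distribution function of the sum of an exponential and an independent nonnegative random
variable. -/
lemma expMeasure_prod_real {lam : ℝ} (hlam : 0 < lam) {b : Measure ℝ} [IsProbabilityMeasure b]
    (hb : b (Iio 0) = 0) {t : ℝ} (ht : 0 ≤ t) :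
    ((expMeasure lam).prod b).real {a | a.1 + a.2 ≤ t} =
      convFun (fun v => lam * Real.exp (-lam * v)) (fun u => b.real (Iic u)) t := by
  have := isProbabilityMeasure_expMeasure hlam
  have hm : MeasurableSet {a : ℝ × ℝ | a.1 + a.2 ≤ t} :=
    measurableSet_le (by fun_prop) (by fun_prop)
  rw [← integral_indicator_one hm, integral_prod _ (show Integrable
    ({a : ℝ × ℝ | a.1 + a.2 ≤ t}.indicator (1 : ℝ × ℝ → ℝ)) _ from
      (integrable_const (1 : ℝ)).indicator hm)]
  have h1 : ∀ x, ∫ y, {a : ℝ × ℝ | a.1 + a.2 ≤ t}.indicator 1 (x, y) ∂b = b.real (Iic (t - x)) := by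
    intro x
    rw [← integral_indicator_one measurableSet_Iic]
    congr 1 with y
    simp [indicator_apply, le_sub_iff_add_le']
  simp only [h1]
  rw [integral_expMeasure hlam, convFun, integral_Icc_eq_integral_Ioc,
    ← intervalIntegral.integral_of_le ht]
  have h2 := intervalIntegral.integral_comp_sub_left (a := 0) (b := t)
    (fun u => lam * Real.exp (-lam * (t - u)) * b.real (Iic u)) t
  rw [sub_self, sub_zero] at h2
  -- After the reflection `u = t - x` the two integrals differ only over `x > t`, where `b` gives
  -- `(-∞, t - x]` no mass.
  rw [← h2, intervalIntegral.integral_of_le ht,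
    ← setIntegral_eq_of_subset_of_forall_sdiff_eq_zero measurableSet_Ioi Ioc_subset_Ioi_self]
  · simp
  · intro x hx
    have hx' : t - x < 0 := by
      by_contra! h
      exact hx.2 ⟨hx.1, by linarith⟩
    rw [sub_sub_cancel, measureReal_def (s := Iic _), measure_mono_null (Iic_subset_Iio.2 hx') hb,
      ENNReal.toReal_zero, mul_zero]

end Cycle

end MGInf

end

theorem mainTheorem5 {Ω : Type*} [MeasurableSpace Ω] (P : Measure Ω) [IsProbabilityMeasure P]
    (lam rho : ℝ) (hlam : 0 < lam) (hrho : 0 < rho) (β : ℝ → ℝ)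
    (hβ : ∀ t : ℝ, 0 ≤ t → IntervalIntegrable β volume 0 t)
    (hβ_lower : ∀ t : ℝ, 0 < t → -lam ≤ (∫ u in (0 : ℝ)..t, β u) / t)
    (hβ_upper : ∀ t : ℝ, 0 < t → (∫ u in (0 : ℝ)..t, β u) / t ≤ lam / (Real.exp rho - 1))
    (X S : ℕ → Ω → ℝ) (hQ : MGInf.IsQueue P lam (MGInf.serviceCDF lam rho β) X S) :
    -- the busy period almost surely ends
    (∀ᵐ ω ∂P, (MGInf.emptyTimes X S ω).Nonempty) ∧
    -- the Laplace transforms of the busy cycle and of the busy period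
    (∀ s : ℝ, 0 ≤ s → ∫ ω, Real.exp (-s * MGInf.cycleLength X S ω) ∂P =
      lam / (lam + s) * ∫ ω, Real.exp (-s * MGInf.busyLength X S ω) ∂P) ∧
    -- the distribution function of the busy cycle; the two convolution integrals converge
    ∀ t : ℝ, 0 ≤ t →
      IntegrableOn (fun u => MGInf.firstFactor lam rho β (t - u)) (Icc 0 t)
        (MGInf.seriesMeasure lam rho β) ∧
      IntegrableOn (fun u => lam * Real.exp (-lam * (t - u)) * MGInf.busyExpr lam rho β u)
        (Icc 0 t) ∧
      P.real {ω | MGInf.cycleLength X S ω ≤ t} =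
        MGInf.convFun (fun v => lam * Real.exp (-lam * v)) (MGInf.busyExpr lam rho β) t := by
  open MGInf in
  obtain ⟨L, hL, hpL⟩ := exists_tendsto_emptyProb (rho := rho) (β := β) hlam
  have hE : ∀ᵐ ω ∂P, ω ∈ busyEnds X S :=
    hQ.ae_mem_busyEnds (d := fun y => posProb lam rho β * extKernel lam β y) hlam
      (hasDerivAt_emptyProb hβ) (continuous_const.mul (continuous_extKernel hβ))
      (fun y hy => serviceCDF_mul_emptyProb hlam hrho hy)
      (fun y hy => ⟨(emptyProb_pos hlam hrho hy).le, emptyProb_le_one hlam hrho hy⟩) hL hpL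
  obtain ⟨Φ, hΦ, hBΦ⟩ := hQ.exists_busyLength_ae_eq hE
  have hX := hQ.measurable_interarrival 0
  have hB : AEMeasurable (busyLength X S) P :=
    ⟨_, hΦ.comp ((hQ.measurable_service 0).prodMk (hQ.measurable_pathFrom 1)), hBΦ⟩
  -- The busy period agrees almost surely with a measurable function of variables independent of `X
  -- 0`, which is enough for independence.
  have hind : IndepFun (X 0) (busyLength X S) P :=
    (hQ.indepFun_idle.comp measurable_id hΦ).congr .rfl hBΦ.symm
  have hcyc : cycleLength X S = fun ω => X 0 ω + busyLength X S ω := by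
    funext ω
    simp [cycleLength, idleLength, arrival]
  have hb : IsProbabilityMeasure (P.map (busyLength X S)) := Measure.isProbabilityMeasure_map hB
  have hb0 : P.map (busyLength X S) (Iio 0) = 0 := by
    rw [Measure.map_apply_of_aemeasurable hB measurableSet_Iio]
    convert! measure_empty (μ := P)
    ext ω
    simp [busyLength_nonneg]
  have hexpr : busyExpr lam rho β = fun u => (P.map (busyLength X S)).real (Iic u) :=
    funext fun u => (busyExpr_eq hlam hrho hβ hQ hE hB u).2
  refine ⟨?_, fun s hs => ?_, fun t ht => ⟨(busyExpr_eq hlam hrho hβ hQ hE hB t).1, ?_, ?_⟩⟩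
  · filter_upwards [hE, hQ.ae_tendsto_busyValue] with ω h1 h2
    exact (h2.1 h1).nonempty
  · have hm : Measurable fun x : ℝ => Real.exp (-s * x) := by fun_prop
    have h := (hind.comp hm hm).integral_fun_mul_eq_mul_integral
      (hm.comp hX).aestronglyMeasurable (hm.comp_aemeasurable hB).aestronglyMeasurable
    have h1 : ∫ ω, Real.exp (-s * X 0 ω) ∂P = lam / (lam + s) := by
      rw [← integral_exp_neg_mul_expMeasure hlam hs, ← hQ.law_interarrival 0,
        integral_map hX.aemeasurable hm.aestronglyMeasurable]
    simp only [hcyc, mul_add, Real.exp_add]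
    exact h.trans (congrArg (· * _) h1)
  · rw [hexpr]
    refine Integrable.mul_bdd (c := 1) ?_ ?_ (ae_of_all _ fun u => abs_measureReal_le_one _ _)
    · exact Continuous.integrableOn_Icc (by fun_prop)
    · exact (measurable_real_Iic _).aestronglyMeasurable
  · have hm : MeasurableSet {a : ℝ × ℝ | a.1 + a.2 ≤ t} :=
      measurableSet_le (by fun_prop) (by fun_prop)
    rw [hexpr, ← expMeasure_prod_real hlam hb0 ht, ← hQ.law_interarrival 0,
      ← hind.map_prod_eq_prod_map_map hX.aemeasurable hB, measureReal_def, measureReal_def,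
      Measure.map_apply_of_aemeasurable (hX.aemeasurable.prodMk hB) hm, hcyc]
    rfl
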